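/- Let $M,N\ge 1$ be integers and $\eta>0$, $T_s>0$. Let $h_{r,t}(\cdot)$, $1\le r\le N$, $1\le t\le M$, be independent, identically distributed, zero-mean, wide-sense stationary, circularly symmetric complex Gaussian processes (Rayleigh fading) with $\mathbb E|h_{r,t}(s)|^2=1$ and common correlation coefficient $\rho_h(\tau)=\mathbb E[h_{r,t}(s)h_{r,t}^{*}(s-\tau)]$, and assume that $\varrho_1=|\rho_h(T_s)|<1$. The instantaneous mutual information (IMI) of the $M$-transmitter, $N$-receiver OSTBC-MIMO system is $$\mathcal I_l=\log_2\Big[1+\frac{\eta}{M}\sum_{r=1}^N\sum_{t=1}^M|h_{r,t}(lT_s)|^2\Big],\qquad l=1,2,\dots .$$ For a threshold $\mathcal I_{th}\ge 0$ let $X_l=1$ if $\mathcal I_l\ge\mathcal I_{th}$ and $X_l=0$ otherwise. Let $N_{\mathcal I}(\mathcal I_{th})$ be the level-crossing rate, i.e. the expected number of down-crossings per unit time, $$N_{\mathcal I}(\mathcal I_{th})=\frac{1}{(L-1)T_s}\,\mathbb E\big[\#\{2\le l\le L: X_{l-1}=1,\ X_l=0\}\big],\qquad L\ge2 .$$ Write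 $\Gamma(a,z)=\int_z^\infty t^{a-1}e^{-t}\,dt$ and $\gamma(a,z)=\int_0^z t^{a-1}e^{-t}\,dt$. Then, for every $L\ge 2$, $$N_{\mathcal I}(\mathcal I_{th})=\frac{\mathbb E\big[\sum_{l=2}^L(X_l-X_{l-1})^2\big]}{2(L-1)T_s}=\frac{\Pr\{X_l=1\}-\Pr\{X_l=1,X_{l-1}=1\}}{T_s}\quad(l\ge2),$$ and $$N_{\mathcal I}(\mathcal I_{th})=\frac{\Gamma\big(MN,\tfrac{M(2^{\mathcal I_{th}}-1)}{\eta}\big)}{(MN-1)!\,T_s}-\frac{(1-\varrho_1^2)^{MN}}{(MN-1)!\,T_s}\,S,\qquad S=\sum_{k=0}^\infty\frac{\varrho_1^{2k}\,\Gamma^2\big(k+MN,\tfrac{M(2^{\mathcal I_{th}}-1)}{\eta(1-\varrho_1^2)}\big)}{k!\,(MN+k-1)!},$$ where the series converges (with the convention $0^0=1$ if $\varrho_1=0$). If moreover $\mathcal I_{th}>0$, then $N_{\mathcal I}(\mathcal I_{th})>0$ and the average outage duration $\overline t_{\mathcal I}(\mathcal I_{th})=\Pr\{\mathcal I_l\le\mathcal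 I_{th}\}/N_{\mathcal I}(\mathcal I_{th})$, $l\ge1$, satisfies $$\frac{\overline t_{\mathcal I}(\mathcal I_{th})}{T_s}=\frac{\gamma\big(MN,\tfrac{M(2^{\mathcal I_{th}}-1)}{\eta}\big)}{\Gamma\big(MN,\tfrac{M(2^{\mathcal I_{th}}-1)}{\eta}\big)-(1-\varrho_1^2)^{MN}S}.$$ For $M=N=1$, $\mathcal I_l$ is the SISO IMI $\log_2(1+\eta|h(lT_s)|^2)$, where $h=h_{1,1}$, and the two formulas become $$N_{\mathcal I}(\mathcal I_{th})=\frac{e^{-(2^{\mathcal I_{th}}-1)/\eta}}{T_s}-\frac{1-\varrho_1^2}{T_s}S_1,\qquad \frac{\overline t_{\mathcal I}(\mathcal I_{th})}{T_s}=\frac{1-e^{-(2^{\mathcal I_{th}}-1)/\eta}}{e^{-(2^{\mathcal I_{th}}-1)/\eta}-(1-\varrho_1^2)S_1}\ \ (\mathcal I_{th}>0),$$ with $S_1=\sum_{k=0}^\infty\Big[\frac{\varrho_1^k}{k!}\Gamma\big(k+1,\tfrac{2^{\mathcal I_{th}}-1}{\eta(1-\varrho_1^2)}\big)\Big]^2$.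 -/

import Mathlib

open MeasureTheory ProbabilityTheory

noncomputable section

/-- The upper incomplete gamma function `Γ(a, z) = ∫_z^∞ t^(a-1) e^(-t) dt`. -/
def upperIncGamma (a z : ℝ) : ℝ := ∫ t in Set.Ioi z, t ^ (a - 1) * Real.exp (-t)

/-- The lower incomplete gamma function `γ(a, z) = ∫_0^z t^(a-1) e^(-t) dt`. -/
def lowerIncGamma (a z : ℝ) : ℝ := ∫ t in (0 : ℝ)..z, t ^ (a - 1) * Real.exp (-t)

/-- A unit-power Rayleigh fading process `h` with temporal correlation coefficient `ρ`: a zero-mean,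
wide-sense stationary, circularly symmetric complex Gaussian process such that
`E[h(t) h(t-τ)^*] = ρ(τ)` and `E[|h(t)|²] = ρ(0) = 1`. The real and imaginary parts are jointly
Gaussian (Gaussianity in `ℂ` viewed as a real vector space), and circular symmetry of a zero-mean
complex Gaussian process is the vanishing of `E[h(s) h(t)]`. -/
structure IsRayleighProcess {Ω : Type*} [MeasurableSpace Ω] (P : Measure Ω)
    (h : ℝ → Ω → ℂ) (ρ : ℝ → ℂ) : Prop where
  measurable : ∀ t, Measurable (h t)
  gaussian : IsGaussianProcess h P
  mean_zero : ∀ t, ∫ ω, h t ω ∂P = 0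
  correlation : ∀ t τ, ∫ ω, h t ω * (starRingEnd ℂ) (h (t - τ) ω) ∂P = ρ τ
  circular : ∀ s t, ∫ ω, h s ω * h t ω ∂P = 0
  unit_power : ρ 0 = 1

/-- A MIMO Rayleigh channel with `N` receive and `M` transmit antennas: the `N * M` subchannel
processes are mutually independent as random functions of time, and all of them are Rayleigh
processes with the same `ρ`; as `ρ` determines the law of such a process, they are identically
distributed. -/
structure IsRayleighMIMO {Ω : Type*} [MeasurableSpace Ω] (P : Measure Ω) {N M : ℕ}
    (h : Fin N → Fin M → ℝ → Ω → ℂ) (ρ : ℝ → ℂ) : Prop where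
  rayleigh : ∀ r t, IsRayleighProcess P (h r t) ρ
  indep : iIndepFun (fun (p : Fin N × Fin M) (ω : Ω) (s : ℝ) => h p.1 p.2 s ω) P

/-- SISO instantaneous mutual information at time `l * Ts`. -/
def sisoIMI {Ω : Type*} (η Ts : ℝ) (h : ℝ → Ω → ℂ) (l : ℕ) (ω : Ω) : ℝ :=
  Real.logb 2 (1 + η * ‖h (l * Ts) ω‖ ^ 2)

/-- OSTBC-MIMO instantaneous mutual information at time `l * Ts`. -/
def ostbcIMI {Ω : Type*} {N M : ℕ} (η Ts : ℝ) (h : Fin N → Fin M → ℝ → Ω → ℂ)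
    (l : ℕ) (ω : Ω) : ℝ :=
  Real.logb 2 (1 + η / M * ∑ r, ∑ t, ‖h r t (l * Ts) ω‖ ^ 2)

/-- The clipped binary sequence `X_l = 1` if `I_l ≥ θ`, and `X_l = 0` if `I_l < θ`. -/
def clip {Ω : Type*} (I : ℕ → Ω → ℝ) (θ : ℝ) (l : ℕ) (ω : Ω) : ℝ :=
  if θ ≤ I l ω then 1 else 0

/-- The number of up- and down-crossings of the level `θ` by `I_1, …, I_L`. -/
def crossings {Ω : Type*} (I : ℕ → Ω → ℝ) (θ : ℝ) (L : ℕ) (ω : Ω) : ℝ :=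
  ∑ l ∈ Finset.Icc 2 L, (clip I θ l ω - clip I θ (l - 1) ω) ^ 2

/-- The number of down-crossings of the level `θ` by `I_1, …, I_L`: the number of `l ∈ {2, …, L}`
with `X_{l-1} = 1` and `X_l = 0`. -/
def downCrossings {Ω : Type*} (I : ℕ → Ω → ℝ) (θ : ℝ) (L : ℕ) (ω : Ω) : ℝ :=
  ∑ l ∈ Finset.Icc 2 L, clip I θ (l - 1) ω * (1 - clip I θ l ω)

/-- The expected crossing rate (up- and down-crossings) on `Ts ≤ t ≤ L * Ts`. -/
def crossingRate {Ω : Type*} [MeasurableSpace Ω] (P : Measure Ω) (I : ℕ → Ω → ℝ)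
    (Ts θ : ℝ) (L : ℕ) : ℝ :=
  (∫ ω, crossings I θ L ω ∂P) / (((L : ℝ) - 1) * Ts)

/-- The level-crossing rate: the expected number of down-crossings of the level `θ` per unit time
on `Ts ≤ t ≤ L * Ts`. -/
def levelCrossingRate {Ω : Type*} [MeasurableSpace Ω] (P : Measure Ω) (I : ℕ → Ω → ℝ)
    (Ts θ : ℝ) (L : ℕ) : ℝ :=
  (∫ ω, downCrossings I θ L ω ∂P) / (((L : ℝ) - 1) * Ts)

/-- The average outage duration: the outage probability `P(I_l ≤ θ)` divided by the level-crossing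
rate. -/
def averageOutageDuration {Ω : Type*} [MeasurableSpace Ω] (P : Measure Ω) (I : ℕ → Ω → ℝ)
    (Ts θ : ℝ) (l L : ℕ) : ℝ :=
  P.real {ω | I l ω ≤ θ} / levelCrossingRate P I Ts θ L

end

/-!
Two samples `U`, `V` of a subchannel at lag `Ts` decorrelate: with `r = ρ Ts`, one has
`U = r V + W`, where `V` and `W` are independent circular Gaussian variables of power `1` and
`1 - |r|²`. Conditioning on `V` shows that the joint characteristic function of `(|U|², |V|²)` is
`((1 - is)(1 - it) + |r|² s t)⁻¹`, so by independence the two total powers of the `MN` subchannels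
have its `MN`-th power as joint characteristic function. Expanding the latter in powers of
`q = |r|²` gives `∑ k, w k * φ (MN + k) s * φ (MN + k) t`, where `w` is a negative binomial weight
and `φ a` is the characteristic function of a gamma law of shape `a` and scale `1 - q`: the pair of
powers has Kibble's bivariate gamma law, a mixture of products of gamma laws, whose joint tail is
the series in the theorem.

Up- and down-crossings differ by a boundary term of mean zero, and a down-crossing at a given sample
has probability `P(X_l = 1) - P(X_l = X_{l-1} = 1)`. The mutual information is an increasing
function of the total power, which turns these probabilities into marginal and joint gamma tails.
-/

open scoped InnerProductSpace ComplexConjugate Topology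

section IncompleteGamma

variable {a z : ℝ}

lemma integrableOn_rpow_mul_exp_neg_Ioi (ha : 0 < a) :
    IntegrableOn (fun t : ℝ => t ^ (a - 1) * Real.exp (-t)) (Set.Ioi 0) := by
  simpa only [mul_comm] using Real.GammaIntegral_convergent ha

lemma lowerIncGamma_add_upperIncGamma (ha : 0 < a) (hz : 0 ≤ z) :
    lowerIncGamma a z + upperIncGamma a z = Real.Gamma a := by
  have hint := integrableOn_rpow_mul_exp_neg_Ioi ha
  rw [lowerIncGamma, upperIncGamma, intervalIntegral.integral_of_le hz,
    ← setIntegral_union Set.Ioc_disjoint_Ioi_same measurableSet_Ioi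
      (hint.mono_set Set.Ioc_subset_Ioi_self) (hint.mono_set (Set.Ioi_subset_Ioi hz)),
    Set.Ioc_union_Ioi_eq_Ioi hz, Real.Gamma_eq_integral ha]
  simp only [mul_comm]

lemma upperIncGamma_pos (ha : 0 < a) (hz : 0 ≤ z) : 0 < upperIncGamma a z := by
  have hpos : ∀ t ∈ Set.Ioi z, 0 < t ^ (a - 1) * Real.exp (-t) := fun t ht => by
    have : 0 < t := hz.trans_lt ht
    positivity
  have hint := (integrableOn_rpow_mul_exp_neg_Ioi ha).mono_set (Set.Ioi_subset_Ioi hz)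
  rw [upperIncGamma, setIntegral_pos_iff_support_of_nonneg_ae
    (ae_restrict_of_forall_mem measurableSet_Ioi fun t ht => (hpos t ht).le) hint,
    Set.inter_eq_right.2 fun t ht => Function.mem_support.2 (hpos t ht).ne']
  simp

lemma lowerIncGamma_pos (ha : 0 < a) (hz : 0 < z) : 0 < lowerIncGamma a z := by
  refine intervalIntegral.intervalIntegral_pos_of_pos_on ?_
    (fun t ht => mul_pos (Real.rpow_pos_of_pos ht.1 _) (Real.exp_pos _)) hz
  rw [intervalIntegrable_iff_integrableOn_Ioc_of_le hz.le]
  exact (integrableOn_rpow_mul_exp_neg_Ioi ha).mono_set Set.Ioc_subset_Ioi_self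

lemma upperIncGamma_one (z : ℝ) : upperIncGamma 1 z = Real.exp (-z) := by
  simp only [upperIncGamma, sub_self, Real.rpow_zero, one_mul, integral_exp_neg_Ioi]

lemma lowerIncGamma_one (z : ℝ) : lowerIncGamma 1 z = 1 - Real.exp (-z) := by
  simp [lowerIncGamma]

end IncompleteGamma

section GammaLaw

variable {a r x : ℝ}

lemma integral_gammaMeasure {E : Type*} [NormedAddCommGroup E] [NormedSpace ℝ E] (ha : 0 < a)
    (hr : 0 < r) (f : ℝ → E) :
    ∫ x, f x ∂(gammaMeasure a r) = ∫ x in Set.Ioi (0 : ℝ),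
      (r ^ a / Real.Gamma a * x ^ (a - 1) * Real.exp (-(r * x))) • f x := by
  have hmeas : Measurable (gammaPDF a r) := (measurable_gammaPDFReal a r).ennreal_ofReal
  rw [gammaMeasure, integral_withDensity_eq_integral_toReal_smul hmeas (by simp [gammaPDF]),
    ← integral_Ici_eq_integral_Ioi, ← integral_indicator measurableSet_Ici]
  congr 1 with x
  rw [gammaPDF, ENNReal.toReal_ofReal (gammaPDFReal_nonneg ha hr x), gammaPDFReal]
  by_cases hx : 0 ≤ x <;> simp [hx]

lemma gammaMeasure_real_Ici (ha : 0 < a) (hr : 0 < r) (hx : 0 ≤ x) :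
    (gammaMeasure a r).real (Set.Ici x) = upperIncGamma a (r * x) / Real.Gamma a := by
  have hdensity : ∀ y ∈ Set.Ioi x, r ^ a / Real.Gamma a * y ^ (a - 1) * Real.exp (-(r * y)) =
      r / Real.Gamma a * ((r * y) ^ (a - 1) * Real.exp (-(r * y))) := fun y hy => by
    rw [Real.mul_rpow hr.le (hx.trans (le_of_lt hy)), Real.rpow_sub_one hr.ne']
    field_simp
  calc (gammaMeasure a r).real (Set.Ici x)
      = ∫ y, (Set.Ioi x).indicator 1 y ∂(gammaMeasure a r) := by
        rw [integral_indicator_one measurableSet_Ioi,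
          measureReal_congr (Ioi_ae_eq_Ici' (by simp [gammaMeasure]))]
    _ = ∫ y in Set.Ioi x, r ^ a / Real.Gamma a * y ^ (a - 1) * Real.exp (-(r * y)) := by
        rw [integral_gammaMeasure ha hr, ← Set.inter_eq_right.2 (Set.Ioi_subset_Ioi hx),
          ← setIntegral_indicator measurableSet_Ioi, Set.inter_eq_right.2 (Set.Ioi_subset_Ioi hx)]
        congr 1 with y
        by_cases hy : x < y <;> simp [hy]
    _ = upperIncGamma a (r * x) / Real.Gamma a := by
        rw [setIntegral_congr_fun measurableSet_Ioi hdensity, integral_const_mul,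
          integral_comp_mul_left_Ioi (fun y => y ^ (a - 1) * Real.exp (-y)) x hr, upperIncGamma,
          smul_eq_mul]
        field_simp

lemma gammaMeasure_real_Iic (ha : 0 < a) (hr : 0 < r) (hx : 0 ≤ x) :
    (gammaMeasure a r).real (Set.Iic x) = lowerIncGamma a (r * x) / Real.Gamma a := by
  have := isProbabilityMeasure_gammaMeasure ha hr
  have hΓ := (Real.Gamma_pos_of_pos ha).ne'
  rw [← Set.compl_Ioi, probReal_compl_eq_one_sub measurableSet_Ioi,
    measureReal_congr (Ioi_ae_eq_Ici' (by simp [gammaMeasure])), gammaMeasure_real_Ici ha hr hx,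
    one_sub_div hΓ, ← lowerIncGamma_add_upperIncGamma ha (mul_nonneg hr.le hx),
    add_sub_cancel_right]

lemma gammaMeasure_natCast_real_Ici {n : ℕ} (hn : 0 < n) (hx : 0 ≤ x) :
    (gammaMeasure n 1).real (Set.Ici x) = upperIncGamma n x / (n - 1).factorial := by
  rw [gammaMeasure_real_Ici (Nat.cast_pos.2 hn) one_pos hx, one_mul, ← Real.Gamma_nat_eq_factorial,
    Nat.cast_pred hn, sub_add_cancel]

lemma gammaMeasure_natCast_real_Iic {n : ℕ} (hn : 0 < n) (hx : 0 ≤ x) :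
    (gammaMeasure n 1).real (Set.Iic x) = lowerIncGamma n x / (n - 1).factorial := by
  rw [gammaMeasure_real_Iic (Nat.cast_pos.2 hn) one_pos hx, one_mul, ← Real.Gamma_nat_eq_factorial,
    Nat.cast_pred hn, sub_add_cancel]

lemma mgf_id_gammaMeasure (ha : 0 < a) (hr : 0 < r) {s : ℝ} (hs : s < r) :
    mgf id (gammaMeasure a r) s = (1 - s / r) ^ (-a) := by
  have hrs : 0 < r - s := sub_pos.2 hs
  have hΓ := (Real.Gamma_pos_of_pos ha).ne'
  calc mgf id (gammaMeasure a r) s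
      = ∫ x in Set.Ioi (0 : ℝ),
          r ^ a / Real.Gamma a * (x ^ (a - 1) * Real.exp (-((r - s) * x))) := by
        rw [mgf, integral_gammaMeasure ha hr]
        congr 1 with x
        rw [smul_eq_mul, mul_assoc, mul_assoc, ← Real.exp_add, id]
        ring_nf
    _ = (1 - s / r) ^ (-a) := by
        rw [integral_const_mul, Real.integral_rpow_mul_exp_neg_mul_Ioi ha hrs,
          Real.div_rpow zero_le_one hrs.le, one_sub_div hr.ne', Real.rpow_neg (by positivity),
          Real.div_rpow hrs.le hr.le, Real.one_rpow]
        field_simp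

lemma Iio_subset_interior_integrableExpSet_gammaMeasure (ha : 0 < a) (hr : 0 < r) :
    Set.Iio r ⊆ interior (integrableExpSet id (gammaMeasure a r)) := by
  refine isOpen_Iio.subset_interior_iff.2 fun s hs => not_imp_comm.1 integral_undef ?_
  have : 0 < 1 - s / r := sub_pos.2 ((div_lt_one hr).2 hs)
  change mgf id (gammaMeasure a r) s ≠ 0
  rw [mgf_id_gammaMeasure ha hr hs]
  positivity

/-- Both sides are analytic on the half-plane and agree on its real points. -/
lemma complexMGF_id_gammaMeasure (ha : 0 < a) (hr : 0 < r) {z : ℂ} (hz : z.re < r) :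
    complexMGF id (gammaMeasure a r) z = (1 - z / r) ^ (-a : ℂ) := by
  have hleft : AnalyticOnNhd ℂ (complexMGF id (gammaMeasure a r)) {z | z.re < r} :=
    analyticOnNhd_complexMGF.mono fun z hz =>
      Iio_subset_interior_integrableExpSet_gammaMeasure ha hr hz
  have hright : AnalyticOnNhd ℂ (fun z : ℂ => (1 - z / r) ^ (-a : ℂ)) {z | z.re < r} :=
    fun z hz => by
      have hslit : 1 - z / r ∈ Complex.slitPlane :=
        Or.inl (by simpa [Complex.div_ofReal_re, div_lt_one hr] using hz)
      fun_prop (disch := exact hslit)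
  have hreal : Set.EqOn (fun s : ℝ => complexMGF id (gammaMeasure a r) s)
      (fun s : ℝ => (1 - (s : ℂ) / r) ^ (-a : ℂ)) (Set.Iio r) := fun s hs => by
    have : 0 ≤ 1 - s / r := sub_nonneg.2 ((div_le_one hr).2 (le_of_lt hs))
    simp only [complexMGF_ofReal, mgf_id_gammaMeasure ha hr hs, Complex.ofReal_cpow this]
    push_cast
    rfl
  have hzero : Filter.Tendsto ((↑) : ℝ → ℂ) (𝓝[≠] 0) (𝓝[≠] 0) :=
    (Complex.continuous_ofReal.tendsto' 0 0 Complex.ofReal_zero).inf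
      (by simp)
  exact hleft.eqOn_of_preconnected_of_frequently_eq hright
    ((convex_halfSpace_re_lt r).isPreconnected) (z₀ := 0) hr
    (hzero.frequently ((hreal.eventuallyEq_of_mem (Iio_mem_nhds hr)).filter_mono
      nhdsWithin_le_nhds).frequently) hz

lemma charFun_gammaMeasure (ha : 0 < a) (hr : 0 < r) (t : ℝ) :
    charFun (gammaMeasure a r) t = (1 - t * Complex.I / r) ^ (-a : ℂ) := by
  rw [← complexMGF_id_mul_I, complexMGF_id_gammaMeasure ha hr (by simpa using hr)]

end GammaLaw

section NegativeBinomial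

lemma hasSum_multichoose_mul_geometric {𝕜 : Type*} [NormedField 𝕜] [CompleteSpace 𝕜]
    {n : ℕ} (hn : 0 < n) {r : 𝕜} (hr : ‖r‖ < 1) :
    HasSum (fun k => n.multichoose k * r ^ k) ((1 - r) ^ n)⁻¹ := by
  obtain ⟨d, rfl⟩ := Nat.exists_eq_add_one.2 hn
  have hchoose (k : ℕ) : (d + 1).multichoose k = (k + d).choose d := by
    rw [Nat.multichoose_eq, Nat.add_right_comm, Nat.add_sub_cancel, add_comm d k,
      Nat.choose_symm_add]
  simpa only [hchoose, one_div] using hasSum_choose_mul_geometric_of_norm_lt_one d hr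

lemma cast_multichoose_eq_div {n : ℕ} (hn : 0 < n) (k : ℕ) :
    (n.multichoose k : ℝ) = (n + k - 1).factorial / (k.factorial * (n - 1).factorial) := by
  rw [Nat.multichoose_eq, Nat.cast_choose ℝ (by omega), show n + k - 1 - k = n - 1 by omega]

/-- The probability that `k` failures of probability `q` precede the `n`-th success in independent
trials: the weights of the negative binomial law. -/
noncomputable def negBinomialWeight (n : ℕ) (q : ℝ) (k : ℕ) : ℝ :=
  (1 - q) ^ n * (n.multichoose k * q ^ k)

variable {n : ℕ} {q : ℝ}

lemma negBinomialWeight_nonneg (hq₀ : 0 ≤ q) (hq₁ : q < 1) (k : ℕ) :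
    0 ≤ negBinomialWeight n q k :=
  mul_nonneg (pow_nonneg (sub_nonneg.2 hq₁.le) n) (by positivity)

lemma negBinomialWeight_zero_pos (hq₁ : q < 1) : 0 < negBinomialWeight n q 0 := by
  simpa [negBinomialWeight] using pow_pos (sub_pos.2 hq₁) n

lemma hasSum_negBinomialWeight (hn : 0 < n) (hq₀ : 0 ≤ q) (hq₁ : q < 1) :
    HasSum (negBinomialWeight n q) 1 := by
  have h := (hasSum_multichoose_mul_geometric hn
    (by rwa [Real.norm_of_nonneg hq₀] : ‖q‖ < 1)).mul_left ((1 - q) ^ n)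
  rwa [mul_inv_cancel₀ (pow_ne_zero n (sub_pos.2 hq₁).ne')] at h

end NegativeBinomial

section PairCharFun

/-- The characteristic function of a measure on the plane, in coordinates. It replaces `charFun`,
which is not available because `ℝ × ℝ` carries no inner product. -/
noncomputable def pairCharFun (μ : Measure (ℝ × ℝ)) (s t : ℝ) : ℂ :=
  ∫ x, Complex.exp ((s * x.1 + t * x.2) * Complex.I) ∂μ

lemma ext_of_pairCharFun {μ ν : Measure (ℝ × ℝ)} [IsFiniteMeasure μ] [IsFiniteMeasure ν]
    (h : pairCharFun μ = pairCharFun ν) : μ = ν := by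
  refine Measure.ext_of_charFunDual (funext fun L => ?_)
  obtain ⟨c, d, hL⟩ : ∃ c d : ℝ, ∀ x : ℝ × ℝ, L x = c * x.1 + d * x.2 := by
    refine ⟨L (1, 0), L (0, 1), fun x => ?_⟩
    conv_lhs => rw [show x = x.1 • ((1 : ℝ), (0 : ℝ)) + x.2 • ((0 : ℝ), (1 : ℝ)) by ext <;> simp]
    rw [map_add, map_smul, map_smul, smul_eq_mul, smul_eq_mul, mul_comm x.1, mul_comm x.2]
  simp only [charFunDual_apply, hL, Complex.ofReal_add, Complex.ofReal_mul]
  exact congrFun (congrFun h c) d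

lemma pairCharFun_prod (μ ν : Measure ℝ) [SFinite μ] [SFinite ν] (s t : ℝ) :
    pairCharFun (μ.prod ν) s t = charFun μ s * charFun ν t := by
  rw [charFun_apply_real, charFun_apply_real, ← integral_prod_mul, pairCharFun]
  congr 1 with x
  rw [add_mul, Complex.exp_add]

lemma charFun_map_fst (μ : Measure (ℝ × ℝ)) (s : ℝ) :
    charFun (μ.map Prod.fst) s = pairCharFun μ s 0 := by
  rw [charFun_apply_real, integral_map (by fun_prop) (by fun_prop), pairCharFun]
  simp

lemma integrable_cexp_pair (μ : Measure (ℝ × ℝ)) [IsFiniteMeasure μ] (s t : ℝ) :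
    Integrable (fun x : ℝ × ℝ => Complex.exp ((s * x.1 + t * x.2) * Complex.I)) μ := by
  refine Integrable.of_bound (by fun_prop) 1 (ae_of_all _ fun x => ?_)
  simp [Complex.norm_exp]

end PairCharFun

section Kibble

/-- The `k`-th component of Kibble's law: the gamma law of shape `n + k` and rate `(1 - q)⁻¹`. -/
noncomputable def kibbleComponent (n : ℕ) (q : ℝ) (k : ℕ) : Measure ℝ :=
  gammaMeasure ((n + k : ℕ) : ℝ) (1 - q)⁻¹

/-- Kibble's bivariate gamma law with integer shape `n` and correlation `q`: the negative binomial
mixture of the laws of two independent gamma variables of shape `n + k`. It is the joint law of the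
powers of two correlated Rayleigh channels, summed over `n` independent branches. -/
noncomputable def kibbleGamma (n : ℕ) (q : ℝ) : Measure (ℝ × ℝ) :=
  Measure.sum fun k : ℕ => ENNReal.ofReal (negBinomialWeight n q k) •
    (kibbleComponent n q k).prod (kibbleComponent n q k)

variable {n : ℕ} {q : ℝ}

lemma isProbabilityMeasure_kibbleComponent (hn : 0 < n) (hq₁ : q < 1) (k : ℕ) :
    IsProbabilityMeasure (kibbleComponent n q k) :=
  isProbabilityMeasure_gammaMeasure (by positivity) (inv_pos.2 (sub_pos.2 hq₁))

lemma kibbleComponent_real_Ici (hn : 0 < n) (hq₁ : q < 1) {x : ℝ} (hx : 0 ≤ x) (k : ℕ) :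
    (kibbleComponent n q k).real (Set.Ici x) =
      upperIncGamma (k + n) (x / (1 - q)) / (n + k - 1).factorial := by
  obtain ⟨d, rfl⟩ := Nat.exists_eq_add_one.2 hn
  rw [kibbleComponent, gammaMeasure_real_Ici (by positivity) (inv_pos.2 (sub_pos.2 hq₁)) hx,
    inv_mul_eq_div, Nat.add_right_comm d 1, Nat.add_sub_cancel, ← Real.Gamma_nat_eq_factorial]
  push_cast
  ring_nf

lemma charFun_kibbleComponent (hn : 0 < n) (hq₁ : q < 1) (k : ℕ) (t : ℝ) :
    charFun (kibbleComponent n q k) t = ((1 - (1 - q) * (t * Complex.I)) ^ (n + k))⁻¹ := by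
  rw [kibbleComponent, charFun_gammaMeasure (by positivity) (inv_pos.2 (sub_pos.2 hq₁)),
    Complex.ofReal_natCast, Complex.cpow_neg, Complex.cpow_natCast]
  push_cast
  rw [div_inv_eq_mul, mul_comm (t * Complex.I)]

lemma isProbabilityMeasure_kibbleGamma (hn : 0 < n) (hq₀ : 0 ≤ q) (hq₁ : q < 1) :
    IsProbabilityMeasure (kibbleGamma n q) := by
  have := isProbabilityMeasure_kibbleComponent hn hq₁
  have hsum := hasSum_negBinomialWeight hn hq₀ hq₁
  constructor
  simp only [kibbleGamma, Measure.sum_apply _ MeasurableSet.univ, Measure.smul_apply,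
    measure_univ, smul_eq_mul, mul_one]
  rw [← ENNReal.ofReal_tsum_of_nonneg (negBinomialWeight_nonneg hq₀ hq₁) hsum.summable,
    hsum.tsum_eq, ENNReal.ofReal_one]

lemma hasSum_integral_kibbleGamma {E : Type*} [NormedAddCommGroup E] [NormedSpace ℝ E]
    (hq₀ : 0 ≤ q) (hq₁ : q < 1) {f : ℝ × ℝ → E} (hf : Integrable f (kibbleGamma n q)) :
    HasSum (fun k => negBinomialWeight n q k •
        ∫ x, f x ∂((kibbleComponent n q k).prod (kibbleComponent n q k)))
      (∫ x, f x ∂(kibbleGamma n q)) := by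
  have h := hasSum_integral_measure hf
  rw [← kibbleGamma] at h
  simpa only [integral_smul_measure, ENNReal.toReal_ofReal (negBinomialWeight_nonneg hq₀ hq₁ _)]
    using h

lemma hasSum_kibbleGamma_real_prod (hn : 0 < n) (hq₀ : 0 ≤ q) (hq₁ : q < 1) {A B : Set ℝ}
    (hA : MeasurableSet A) (hB : MeasurableSet B) :
    HasSum (fun k => negBinomialWeight n q k *
        ((kibbleComponent n q k).real A * (kibbleComponent n q k).real B))
      ((kibbleGamma n q).real (A ×ˢ B)) := by
  have := isProbabilityMeasure_kibbleComponent hn hq₁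
  have := isProbabilityMeasure_kibbleGamma hn hq₀ hq₁
  have hint : Integrable ((A ×ˢ B).indicator (1 : ℝ × ℝ → ℝ)) (kibbleGamma n q) :=
    (integrable_const (1 : ℝ)).indicator (hA.prod hB)
  simpa only [integral_indicator_one (hA.prod hB), measureReal_prod_prod, smul_eq_mul] using
    hasSum_integral_kibbleGamma hq₀ hq₁ hint

/-- The transforms of the components form a binomial series in `q / (A * B)`, where `A ^ (-n - k)`
and `B ^ (-n - k)` are the transforms of the two gamma factors. -/
lemma pairCharFun_kibbleGamma (hn : 0 < n) (hq₀ : 0 ≤ q) (hq₁ : q < 1) (s t : ℝ) :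
    pairCharFun (kibbleGamma n q) s t =
      (((1 - s * Complex.I) * (1 - t * Complex.I) + q * s * t) ^ n)⁻¹ := by
  have := isProbabilityMeasure_kibbleGamma hn hq₀ hq₁
  have := isProbabilityMeasure_kibbleComponent hn hq₁
  set A : ℂ := 1 - (1 - q) * (s * Complex.I) with hA
  set B : ℂ := 1 - (1 - q) * (t * Complex.I) with hB
  have hnorm (u : ℝ) : 1 ≤ ‖1 - (1 - q) * (u * Complex.I)‖ := by
    simpa using Complex.re_le_norm (1 - (1 - q) * (u * Complex.I))
  have hA₀ : A ≠ 0 := norm_pos_iff.1 (one_pos.trans_le (hnorm s))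
  have hB₀ : B ≠ 0 := norm_pos_iff.1 (one_pos.trans_le (hnorm t))
  have hq₁' : (1 - q : ℂ) ≠ 0 := by exact_mod_cast (sub_pos.2 hq₁).ne'
  have hratio : ‖(q / (A * B) : ℂ)‖ < 1 := by
    rw [norm_div, norm_mul, Complex.norm_of_nonneg hq₀]
    exact (div_le_self hq₀ (one_le_mul_of_one_le_of_one_le (hnorm s) (hnorm t))).trans_lt hq₁
  have hbinomial := (hasSum_multichoose_mul_geometric hn hratio).mul_left
    (((1 - q) / (A * B)) ^ n : ℂ)
  have hmixture := hasSum_integral_kibbleGamma hq₀ hq₁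
    (integrable_cexp_pair (kibbleGamma n q) s t)
  simp only [← pairCharFun.eq_def, pairCharFun_prod, charFun_kibbleComponent hn hq₁, ← hA,
    ← hB] at hmixture
  have hden : A * B - q = (1 - q) * ((1 - s * Complex.I) * (1 - t * Complex.I) + q * s * t) := by
    linear_combination (norm := (rw [hA, hB]; ring_nf)) (q ^ 2 - q) * s * t * Complex.I_sq
  refine hmixture.unique ?_
  convert! hbinomial using 1
  · ext k
    rw [negBinomialWeight, Complex.real_smul]
    push_cast
    simp only [div_pow, mul_pow]
    field_simp
    ring
  · rw [← inv_pow, ← inv_pow, ← mul_pow, one_sub_div (mul_ne_zero hA₀ hB₀), hden, inv_div,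
      div_mul_div_cancel₀ (mul_ne_zero hA₀ hB₀), div_mul_cancel_left₀ hq₁']

lemma kibbleGamma_map_fst (hn : 0 < n) (hq₀ : 0 ≤ q) (hq₁ : q < 1) :
    (kibbleGamma n q).map Prod.fst = gammaMeasure n 1 := by
  have hn' : (0 : ℝ) < n := Nat.cast_pos.2 hn
  have := isProbabilityMeasure_kibbleGamma hn hq₀ hq₁
  have := isProbabilityMeasure_gammaMeasure hn' one_pos
  refine Measure.ext_of_charFun (funext fun s => ?_)
  rw [charFun_map_fst, pairCharFun_kibbleGamma hn hq₀ hq₁, charFun_gammaMeasure hn' one_pos]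
  simp [Complex.cpow_neg]

lemma kibbleGamma_real_Ici_prod_Ici_lt (hn : 0 < n) (hq₀ : 0 ≤ q) (hq₁ : q < 1) {x : ℝ}
    (hx : 0 < x) :
    (kibbleGamma n q).real (Set.Ici x ×ˢ Set.Ici x) < (gammaMeasure n 1).real (Set.Ici x) := by
  have := isProbabilityMeasure_kibbleComponent hn hq₁
  have hzero : 0 < (kibbleComponent n q 0).real (Set.Ici x) ∧
      (kibbleComponent n q 0).real (Set.Ici x) < 1 := by
    have hn' : (0 : ℝ) < (n + 0 : ℕ) := Nat.cast_pos.2 hn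
    have hz : 0 < (1 - q)⁻¹ * x := mul_pos (inv_pos.2 (sub_pos.2 hq₁)) hx
    have hΓ := Real.Gamma_pos_of_pos hn'
    rw [kibbleComponent, gammaMeasure_real_Ici hn' (inv_pos.2 (sub_pos.2 hq₁)) hx.le,
      div_lt_one hΓ]
    refine ⟨div_pos (upperIncGamma_pos hn' hz.le) hΓ, ?_⟩
    rw [← lowerIncGamma_add_upperIncGamma hn' hz.le]
    exact lt_add_of_pos_left _ (lowerIncGamma_pos hn' hz)
  have hjoint := hasSum_kibbleGamma_real_prod hn hq₀ hq₁ (measurableSet_Ici (a := x))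
    (measurableSet_Ici (a := x))
  have hmarginal := hasSum_kibbleGamma_real_prod hn hq₀ hq₁ (measurableSet_Ici (a := x)) .univ
  rw [← kibbleGamma_map_fst hn hq₀ hq₁, map_measureReal_apply measurable_fst measurableSet_Ici,
    ← Set.prod_univ]
  refine hasSum_lt (i := 0) (fun k => ?_) ?_ hjoint hmarginal
  · gcongr
    · exact negBinomialWeight_nonneg hq₀ hq₁ k
    · exact measure_ne_top _ _
    · exact Set.subset_univ _
  · simp only [probReal_univ]
    exact mul_lt_mul_of_pos_left (mul_lt_mul_of_pos_left hzero.2 hzero.1)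
      (negBinomialWeight_zero_pos hq₁)

/-- The `k`-th term of the series `S`, with `n = M N`, `q = ϱ₁²` and `z` the normalized
threshold. -/
noncomputable def jointTailTerm (n : ℕ) (q z : ℝ) (k : ℕ) : ℝ :=
  q ^ k * upperIncGamma (k + n) z ^ 2 / (k.factorial * (n + k - 1).factorial)

lemma hasSum_jointTailTerm (hn : 0 < n) (hq₀ : 0 ≤ q) (hq₁ : q < 1) {x : ℝ} (hx : 0 ≤ x) :
    HasSum (fun k => (1 - q) ^ n / (n - 1).factorial * jointTailTerm n q (x / (1 - q)) k)
      ((kibbleGamma n q).real (Set.Ici x ×ˢ Set.Ici x)) := by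
  convert hasSum_kibbleGamma_real_prod hn hq₀ hq₁ (measurableSet_Ici (a := x))
    (measurableSet_Ici (a := x)) using 2 with k
  rw [kibbleComponent_real_Ici hn hq₁ hx, jointTailTerm, negBinomialWeight,
    cast_multichoose_eq_div hn]
  field_simp

lemma summable_jointTailTerm (hn : 0 < n) (hq₀ : 0 ≤ q) (hq₁ : q < 1) {x : ℝ} (hx : 0 ≤ x) :
    Summable (jointTailTerm n q (x / (1 - q))) := by
  have hq₁' := sub_pos.2 hq₁
  exact (summable_mul_left_iff (div_pos (pow_pos hq₁' n) (by positivity)).ne').1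
    (hasSum_jointTailTerm hn hq₀ hq₁ hx).summable

lemma kibbleGamma_real_Ici_prod_Ici (hn : 0 < n) (hq₀ : 0 ≤ q) (hq₁ : q < 1) {x : ℝ}
    (hx : 0 ≤ x) :
    (kibbleGamma n q).real (Set.Ici x ×ˢ Set.Ici x) =
      (1 - q) ^ n / (n - 1).factorial * ∑' k, jointTailTerm n q (x / (1 - q)) k := by
  rw [← (hasSum_jointTailTerm hn hq₀ hq₁ hx).tsum_eq, tsum_mul_left]

end Kibble

section CircularGaussian

/-- The law of a zero-mean circularly symmetric complex Gaussian variable `Z` with `E|Z|² = τ > 0`,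
given by its density. -/
noncomputable def circularGaussian (τ : ℝ) : Measure ℂ :=
  volume.withDensity fun z => ENNReal.ofReal (Real.exp (-(‖z‖ ^ 2 / τ)) / (Real.pi * τ))

variable {τ : ℝ}

lemma integral_circularGaussian (hτ : 0 < τ) (f : ℂ → ℂ) :
    ∫ z, f z ∂(circularGaussian τ) =
      (Real.pi * τ : ℂ)⁻¹ * ∫ z : ℂ, Complex.exp (-(τ : ℂ)⁻¹ * ‖z‖ ^ 2) * f z := by
  rw [circularGaussian, integral_withDensity_eq_integral_toReal_smul (by fun_prop) (by simp),
    ← integral_const_mul]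
  congr 1 with z
  rw [ENNReal.toReal_ofReal (by positivity), Complex.real_smul]
  push_cast
  ring_nf

lemma one_sub_mul_ofReal_ne_zero (hτ : 0 ≤ τ) {β : ℂ} (hβ : β.re ≤ 0) : 1 - β * τ ≠ 0 := by
  intro h
  have hre : 1 - β.re * τ = 0 := by simpa using congrArg Complex.re h
  nlinarith [mul_nonneg (neg_nonneg.2 hβ) hτ]

lemma re_mul_I_div_one_sub_nonpos (hτ : 0 ≤ τ) (s : ℝ) :
    (s * Complex.I / (1 - s * Complex.I * τ)).re ≤ 0 := by
  rw [Complex.div_re]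
  have hnum : 0 ≤ s * (s * τ) := by nlinarith [mul_nonneg (sq_nonneg s) hτ]
  simp only [Complex.mul_re, Complex.mul_im, Complex.sub_im, Complex.ofReal_re, Complex.ofReal_im,
    Complex.I_re, Complex.I_im, Complex.one_im, mul_zero, mul_one, zero_mul, add_zero, sub_zero,
    zero_div, zero_add, zero_sub, mul_neg]
  exact div_nonpos_of_nonpos_of_nonneg (neg_nonpos.2 hnum) (Complex.normSq_nonneg _)

lemma integral_cexp_quadratic_circularGaussian (hτ : 0 < τ) {β : ℂ} (hβ : β.re ≤ 0) (c w : ℂ) :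
    ∫ z, Complex.exp (β * ‖z‖ ^ 2 + c * ⟪w, z⟫_ℝ) ∂(circularGaussian τ) =
      (1 - β * τ)⁻¹ * Complex.exp (c ^ 2 * ‖w‖ ^ 2 * τ / (4 * (1 - β * τ))) := by
  have hτ₀ : (τ : ℂ) ≠ 0 := by exact_mod_cast hτ.ne'
  have hπ₀ : (Real.pi : ℂ) ≠ 0 := by exact_mod_cast Real.pi_ne_zero
  have hβτ : 1 - β * τ ≠ 0 := one_sub_mul_ofReal_ne_zero hτ.le hβ
  have hre : 0 < ((τ : ℂ)⁻¹ - β).re := by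
    have hinv : 0 < τ⁻¹ := inv_pos.2 hτ
    rw [Complex.sub_re, ← Complex.ofReal_inv, Complex.ofReal_re]
    linarith
  have hfactor : (τ : ℂ)⁻¹ - β = (1 - β * τ) / τ := by field_simp
  calc _ = (Real.pi * τ : ℂ)⁻¹ *
        ∫ z : ℂ, Complex.exp (-((τ : ℂ)⁻¹ - β) * ‖z‖ ^ 2 + c * ⟪w, z⟫_ℝ) := by
        rw [integral_circularGaussian hτ]
        congr 2 with z
        rw [← Complex.exp_add]
        ring_nf
    _ = (Real.pi * τ : ℂ)⁻¹ * (Real.pi / ((τ : ℂ)⁻¹ - β) *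
          Complex.exp (c ^ 2 * ‖w‖ ^ 2 / (4 * ((τ : ℂ)⁻¹ - β)))) := by
        rw [GaussianFourier.integral_cexp_neg_mul_sq_norm_add hre, Complex.finrank_real_complex,
          Nat.cast_ofNat, div_self two_ne_zero, Complex.cpow_one]
    _ = _ := by
        rw [hfactor, ← mul_assoc]
        congr 1 <;> [skip; congr 1] <;> field_simp

lemma integral_cexp_mul_norm_sq_circularGaussian (hτ : 0 < τ) {β : ℂ} (hβ : β.re ≤ 0) :
    ∫ z, Complex.exp (β * ‖z‖ ^ 2) ∂(circularGaussian τ) = (1 - β * τ)⁻¹ := by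
  simpa using integral_cexp_quadratic_circularGaussian hτ hβ 0 0

lemma isProbabilityMeasure_circularGaussian (hτ : 0 < τ) :
    IsProbabilityMeasure (circularGaussian τ) := by
  have hmass := integral_cexp_mul_norm_sq_circularGaussian hτ (β := 0) le_rfl
  rw [isProbabilityMeasure_iff_real]
  simpa using hmass

lemma charFun_circularGaussian (hτ : 0 < τ) (w : ℂ) :
    charFun (circularGaussian τ) w = Complex.exp (-(‖w‖ ^ 2 * τ / 4)) := by
  have h := integral_cexp_quadratic_circularGaussian hτ (β := 0) le_rfl Complex.I w
  simp only [zero_mul, zero_add, sub_zero, inv_one, one_mul, mul_one, Complex.I_sq, neg_mul] at h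
  rw [charFun_apply]
  simp_rw [real_inner_comm w, mul_comm _ Complex.I]
  rw [h, neg_div]

lemma integral_cexp_norm_add_sq_circularGaussian (hτ : 0 < τ) (s : ℝ) (v : ℂ) :
    ∫ z, Complex.exp (s * ‖z + v‖ ^ 2 * Complex.I) ∂(circularGaussian τ) =
      (1 - s * Complex.I * τ)⁻¹ *
        Complex.exp (s * Complex.I / (1 - s * Complex.I * τ) * ‖v‖ ^ 2) := by
  have hβ : (s * Complex.I).re ≤ 0 := by simp
  have hden := one_sub_mul_ofReal_ne_zero hτ.le hβ
  have hexpand : ∀ z : ℂ, Complex.exp (s * ‖z + v‖ ^ 2 * Complex.I) =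
      Complex.exp (s * ‖v‖ ^ 2 * Complex.I) *
        Complex.exp (s * Complex.I * ‖z‖ ^ 2 + 2 * (s * Complex.I) * ⟪v, z⟫_ℝ) := by
    intro z
    rw [← Complex.exp_add, ← Complex.ofReal_pow ‖z + v‖, norm_add_sq_real, real_inner_comm v]
    push_cast
    ring_nf
  simp_rw [hexpand]
  rw [integral_const_mul, integral_cexp_quadratic_circularGaussian hτ hβ, mul_left_comm,
    ← Complex.exp_add]
  congr 2
  field_simp
  ring

lemma integral_cexp_norm_sq_circularGaussian_prod (hτ : 0 < τ) (r : ℂ) (s t : ℝ) :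
    ∫ p : ℂ × ℂ, Complex.exp ((s * ‖p.2 + r * p.1‖ ^ 2 + t * ‖p.1‖ ^ 2) * Complex.I)
        ∂((circularGaussian 1).prod (circularGaussian τ)) =
      ((1 - s * Complex.I * τ) * (1 - t * Complex.I) - s * Complex.I * ‖r‖ ^ 2)⁻¹ := by
  have := isProbabilityMeasure_circularGaussian hτ
  have := isProbabilityMeasure_circularGaussian one_pos
  let F : ℂ × ℂ → ℂ := fun p =>
    Complex.exp ((s * ‖p.2 + r * p.1‖ ^ 2 + t * ‖p.1‖ ^ 2) * Complex.I)
  have hF : Integrable F ((circularGaussian 1).prod (circularGaussian τ)) := by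
    refine Integrable.of_bound (Continuous.aestronglyMeasurable (by fun_prop)) 1
      (Filter.Eventually.of_forall fun p => ?_)
    simp [F, Complex.norm_exp, ← Complex.ofReal_pow]
  have hs : 1 - s * Complex.I * τ ≠ 0 := one_sub_mul_ofReal_ne_zero hτ.le (by simp)
  set β : ℂ := s * Complex.I / (1 - s * Complex.I * τ) * ‖r‖ ^ 2 + t * Complex.I with hβ_def
  have hβ : β.re ≤ 0 := by
    rw [hβ_def, Complex.add_re, ← Complex.ofReal_pow ‖r‖, Complex.re_mul_ofReal,
      Complex.re_ofReal_mul, Complex.I_re, mul_zero, add_zero]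
    exact mul_nonpos_of_nonpos_of_nonneg (re_mul_I_div_one_sub_nonpos hτ.le s) (sq_nonneg _)
  have hinner : ∀ v : ℂ, ∫ z, F (v, z) ∂(circularGaussian τ) =
      (1 - s * Complex.I * τ)⁻¹ * Complex.exp (β * ‖v‖ ^ 2) := by
    intro v
    simp only [F, add_mul _ _ Complex.I, Complex.exp_add]
    rw [integral_mul_const, integral_cexp_norm_add_sq_circularGaussian hτ, mul_assoc,
      ← Complex.exp_add, norm_mul, hβ_def]
    push_cast
    ring_nf
  rw [integral_prod F hF]
  simp_rw [hinner]
  rw [integral_const_mul, integral_cexp_mul_norm_sq_circularGaussian one_pos hβ, ← mul_inv, hβ_def]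
  congr 1
  field_simp
  push_cast
  ring

end CircularGaussian

section Moments

variable {Ω : Type*} [MeasurableSpace Ω] {P : Measure Ω}

lemma integral_sub_mul_mul {𝕜 : Type*} [RCLike 𝕜] {X Y Z : Ω → 𝕜} (hX : MemLp X 2 P)
    (hY : MemLp Y 2 P) (hZ : MemLp Z 2 P) (r : 𝕜) :
    ∫ ω, (X ω - r * Y ω) * Z ω ∂P = (∫ ω, X ω * Z ω ∂P) - r * ∫ ω, Y ω * Z ω ∂P := by
  have hXZ : Integrable (fun ω => X ω * Z ω) P := hX.integrable_mul hZ
  have hYZ : Integrable (fun ω => Y ω * Z ω) P := hY.integrable_mul hZ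
  rw [← integral_const_mul, ← integral_sub hXZ (hYZ.const_mul r)]
  congr 1 with ω
  ring

lemma integral_sub_mul_mul_conj {𝕜 : Type*} [RCLike 𝕜] {X Y Z : Ω → 𝕜} (hX : MemLp X 2 P)
    (hY : MemLp Y 2 P) (hZ : MemLp Z 2 P) (r : 𝕜) :
    ∫ ω, (X ω - r * Y ω) * conj (Z ω) ∂P =
      (∫ ω, X ω * conj (Z ω) ∂P) - r * ∫ ω, Y ω * conj (Z ω) ∂P :=
  integral_sub_mul_mul hX hY hZ.star r

lemma integral_mul_conj_comm {𝕜 : Type*} [RCLike 𝕜] (X Y : Ω → 𝕜) :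
    ∫ ω, X ω * conj (Y ω) ∂P = conj (∫ ω, Y ω * conj (X ω) ∂P) := by
  rw [← integral_conj]
  simp only [map_mul, RCLike.conj_conj, mul_comm]

lemma integral_inner_mul_inner {Z W : Ω → ℂ} (hZ : MemLp Z 2 P) (hW : MemLp W 2 P) (x y : ℂ) :
    ∫ ω, ⟪x, Z ω⟫_ℝ * ⟪y, W ω⟫_ℝ ∂P =
      ((conj x * conj y * ∫ ω, Z ω * W ω ∂P) +
        (conj x * y * ∫ ω, Z ω * conj (W ω) ∂P)).re / 2 := by
  have hZW : Integrable (fun ω => conj x * conj y * (Z ω * W ω)) P :=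
    (hZ.integrable_mul hW).const_mul _
  have hZW' : Integrable (fun ω => conj x * y * (Z ω * conj (W ω))) P :=
    (hZ.integrable_mul hW.star).const_mul _
  have hre := integral_re (hZW.add hZW')
  simp only [RCLike.re_eq_complex_re, Pi.add_apply] at hre
  rw [← integral_const_mul, ← integral_const_mul, ← integral_add hZW hZW', ← hre, ← integral_div]
  congr 1 with ω
  simp only [Complex.inner, Complex.add_re, Complex.mul_re, Complex.mul_im, Complex.conj_re,
    Complex.conj_im]
  ring

lemma hasLaw_circularGaussian {Z : Ω → ℂ} (hG : HasGaussianLaw Z P) (hmean : ∫ ω, Z ω ∂P = 0)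
    (hcirc : ∫ ω, Z ω * Z ω ∂P = 0) {τ : ℝ} (hτ : 0 < τ)
    (hpower : ∫ ω, Z ω * conj (Z ω) ∂P = τ) : HasLaw Z (circularGaussian τ) P := by
  have := hG.isProbabilityMeasure
  have := isProbabilityMeasure_circularGaussian hτ
  have := Measure.isProbabilityMeasure_map (μ := P) hG.aemeasurable
  refine ⟨hG.aemeasurable, Measure.ext_of_charFun (funext fun w => ?_)⟩
  have hinner : ∫ ω, ⟪w, Z ω⟫_ℝ ∂P = 0 := by
    rw [integral_inner hG.integrable, hmean, inner_zero_right]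
  have hvar : ∫ ω, ⟪w, Z ω⟫_ℝ ^ 2 ∂P = ‖w‖ ^ 2 * τ / 2 := by
    simp_rw [pow_two, integral_inner_mul_inner hG.memLp_two hG.memLp_two, hcirc, hpower]
    rw [Complex.conj_mul', mul_zero, zero_add, ← pow_two]
    norm_cast
  rw [hG.charFun_map_eq, variance_of_integral_eq_zero
    (aemeasurable_const.inner hG.aemeasurable) hinner, hinner, hvar, charFun_circularGaussian hτ]
  push_cast
  ring_nf

end Moments

/-- A pair of zero-mean complex variables which are jointly Gaussian and jointly circular (all their
pseudo-covariances `E[XY]` vanish), with unit powers and cross-correlation `E[U V^*] = r`. -/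
structure IsCircularGaussianPair {Ω : Type*} [MeasurableSpace Ω] (P : Measure Ω) (U V : Ω → ℂ)
    (r : ℂ) : Prop where
  gaussian : HasGaussianLaw (fun ω => (U ω, V ω)) P
  mean_fst : ∫ ω, U ω ∂P = 0
  mean_snd : ∫ ω, V ω ∂P = 0
  circular_fst : ∫ ω, U ω * U ω ∂P = 0
  circular_cross : ∫ ω, U ω * V ω ∂P = 0
  circular_snd : ∫ ω, V ω * V ω ∂P = 0
  power_fst : ∫ ω, U ω * conj (U ω) ∂P = 1
  power_snd : ∫ ω, V ω * conj (V ω) ∂P = 1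
  correlation : ∫ ω, U ω * conj (V ω) ∂P = r

namespace IsCircularGaussianPair

variable {Ω : Type*} [MeasurableSpace Ω] {P : Measure Ω} {U V : Ω → ℂ} {r : ℂ}

lemma hasGaussianLaw_residual (h : IsCircularGaussianPair P U V r) :
    HasGaussianLaw (fun ω => (U ω - r * V ω, V ω)) P :=
  h.gaussian.map_fun
    (((ContinuousLinearMap.fst ℝ ℂ ℂ) - (ContinuousLinearMap.mul ℝ ℂ r).comp
      (ContinuousLinearMap.snd ℝ ℂ ℂ)).prod (ContinuousLinearMap.snd ℝ ℂ ℂ))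

lemma integral_residual (h : IsCircularGaussianPair P U V r) : ∫ ω, (U ω - r * V ω) ∂P = 0 := by
  rw [integral_sub h.gaussian.fst.integrable (h.gaussian.snd.integrable.const_mul r),
    integral_const_mul, h.mean_fst, h.mean_snd, mul_zero, sub_zero]

lemma integral_residual_mul_snd (h : IsCircularGaussianPair P U V r) :
    ∫ ω, (U ω - r * V ω) * V ω ∂P = 0 := by
  rw [integral_sub_mul_mul h.gaussian.fst.memLp_two h.gaussian.snd.memLp_two
    h.gaussian.snd.memLp_two, h.circular_cross, h.circular_snd, mul_zero, sub_zero]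

lemma integral_residual_mul_conj_snd (h : IsCircularGaussianPair P U V r) :
    ∫ ω, (U ω - r * V ω) * conj (V ω) ∂P = 0 := by
  rw [integral_sub_mul_mul_conj h.gaussian.fst.memLp_two h.gaussian.snd.memLp_two
    h.gaussian.snd.memLp_two, h.correlation, h.power_snd, mul_one, sub_self]

lemma integral_residual_mul_residual (h : IsCircularGaussianPair P U V r) :
    ∫ ω, (U ω - r * V ω) * (U ω - r * V ω) ∂P = 0 := by
  have hU := h.gaussian.fst.memLp_two
  have hV := h.gaussian.snd.memLp_two
  have hUW : ∫ ω, U ω * (U ω - r * V ω) ∂P = 0 := by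
    simp_rw [mul_comm (U _)]
    rw [integral_sub_mul_mul hU hV hU, h.circular_fst]
    simp_rw [mul_comm (V _)]
    rw [h.circular_cross, mul_zero, sub_zero]
  have hVW : ∫ ω, V ω * (U ω - r * V ω) ∂P = 0 := by
    simp_rw [mul_comm (V _) (_ - _)]
    exact h.integral_residual_mul_snd
  rw [integral_sub_mul_mul hU hV h.hasGaussianLaw_residual.fst.memLp_two, hUW, hVW, mul_zero,
    sub_zero]

lemma integral_residual_mul_conj_residual (h : IsCircularGaussianPair P U V r) :
    ∫ ω, (U ω - r * V ω) * conj (U ω - r * V ω) ∂P = ((1 - ‖r‖ ^ 2 : ℝ) : ℂ) := by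
  have hU := h.gaussian.fst.memLp_two
  have hV := h.gaussian.snd.memLp_two
  have hUW : ∫ ω, U ω * conj (U ω - r * V ω) ∂P = 1 - conj r * r := by
    rw [integral_mul_conj_comm U fun ω => U ω - r * V ω, integral_sub_mul_mul_conj hU hV hU,
      integral_mul_conj_comm V, h.power_fst, h.correlation, map_sub, map_one, map_mul,
      Complex.conj_conj]
  have hVW : ∫ ω, V ω * conj (U ω - r * V ω) ∂P = 0 := by
    rw [integral_mul_conj_comm V fun ω => U ω - r * V ω, h.integral_residual_mul_conj_snd,
      map_zero]
  rw [integral_sub_mul_mul_conj hU hV h.hasGaussianLaw_residual.fst.memLp_two, hUW, hVW, mul_zero,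
    sub_zero, Complex.conj_mul']
  push_cast
  rfl

lemma indepFun_residual (h : IsCircularGaussianPair P U V r) :
    IndepFun (fun ω => U ω - r * V ω) V P := by
  have hG := h.hasGaussianLaw_residual
  refine hG.indepFun_of_covariance_inner fun x y => ?_
  have hmean_residual : ∫ ω, ⟪x, U ω - r * V ω⟫_ℝ ∂P = 0 := by
    rw [integral_inner hG.fst.integrable, h.integral_residual, inner_zero_right]
  have hmean_snd : ∫ ω, ⟪y, V ω⟫_ℝ ∂P = 0 := by
    rw [integral_inner hG.snd.integrable, h.mean_snd, inner_zero_right]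
  rw [covariance, hmean_residual, hmean_snd]
  simp only [sub_zero]
  rw [integral_inner_mul_inner hG.fst.memLp_two hG.snd.memLp_two, h.integral_residual_mul_snd,
    h.integral_residual_mul_conj_snd, mul_zero, mul_zero, add_zero, Complex.zero_re, zero_div]

lemma hasLaw_snd_residual (h : IsCircularGaussianPair P U V r) (hr : ‖r‖ < 1) :
    HasLaw (fun ω => (V ω, U ω - r * V ω))
      ((circularGaussian 1).prod (circularGaussian (1 - ‖r‖ ^ 2))) P := by
  have := h.gaussian.isProbabilityMeasure
  have hG := h.hasGaussianLaw_residual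
  have hσ : 0 < 1 - ‖r‖ ^ 2 := by nlinarith [norm_nonneg r]
  have hlaw_snd : HasLaw V (circularGaussian 1) P :=
    hasLaw_circularGaussian hG.snd h.mean_snd h.circular_snd one_pos (by simpa using h.power_snd)
  have hlaw_residual : HasLaw (fun ω => U ω - r * V ω) (circularGaussian (1 - ‖r‖ ^ 2)) P :=
    hasLaw_circularGaussian hG.fst h.integral_residual h.integral_residual_mul_residual hσ
      h.integral_residual_mul_conj_residual
  refine ⟨hG.snd.aemeasurable.prodMk hG.fst.aemeasurable, ?_⟩
  rw [(indepFun_iff_map_prod_eq_prod_map_map hG.snd.aemeasurable hG.fst.aemeasurable).1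
    h.indepFun_residual.symm, hlaw_snd.map_eq, hlaw_residual.map_eq]

lemma integral_cexp_norm_sq (h : IsCircularGaussianPair P U V r) (hr : ‖r‖ < 1) (s t : ℝ) :
    ∫ ω, Complex.exp ((s * ‖U ω‖ ^ 2 + t * ‖V ω‖ ^ 2) * Complex.I) ∂P =
      ((1 - s * Complex.I) * (1 - t * Complex.I) + ‖r‖ ^ 2 * s * t)⁻¹ := by
  have hσ : 0 < 1 - ‖r‖ ^ 2 := by nlinarith [norm_nonneg r]
  let F : ℂ × ℂ → ℂ := fun p =>
    Complex.exp ((s * ‖p.2 + r * p.1‖ ^ 2 + t * ‖p.1‖ ^ 2) * Complex.I)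
  calc ∫ ω, Complex.exp ((s * ‖U ω‖ ^ 2 + t * ‖V ω‖ ^ 2) * Complex.I) ∂P
      = ∫ ω, F (V ω, U ω - r * V ω) ∂P := by simp only [F, sub_add_cancel]
    _ = ∫ p, F p ∂((circularGaussian 1).prod (circularGaussian (1 - ‖r‖ ^ 2))) :=
        (h.hasLaw_snd_residual hr).integral_comp (f := F)
          (Continuous.aestronglyMeasurable (by fun_prop))
    _ = ((1 - s * Complex.I) * (1 - t * Complex.I) + ‖r‖ ^ 2 * s * t)⁻¹ := by
        rw [integral_cexp_norm_sq_circularGaussian_prod hσ]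
        congr 1
        push_cast
        linear_combination (-(s : ℂ) * t * ‖r‖ ^ 2) * Complex.I_sq

end IsCircularGaussianPair

section SquaredNorms

variable {Ω : Type*} [MeasurableSpace Ω] {P : Measure Ω} {ι : Type*} [Fintype ι] [Nonempty ι]

lemma hasLaw_sum_norm_sq_gammaMeasure {Z : ι → Ω → ℂ}
    (hZ : ∀ i, HasLaw (Z i) (circularGaussian 1) P) (hindep : iIndepFun Z P) :
    HasLaw (fun ω => ∑ i, ‖Z i ω‖ ^ 2) (gammaMeasure (Fintype.card ι) 1) P := by
  have hcard : (0 : ℝ) < Fintype.card ι := by exact_mod_cast Fintype.card_pos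
  have hZm : ∀ i, AEMeasurable (Z i) P := fun i => (hZ i).aemeasurable
  have hsum : AEMeasurable (fun ω => ∑ i, ‖Z i ω‖ ^ 2) P := by fun_prop
  have := hindep.isProbabilityMeasure
  have := isProbabilityMeasure_gammaMeasure hcard one_pos
  have := Measure.isProbabilityMeasure_map (μ := P) hsum
  refine ⟨hsum, Measure.ext_of_charFun (funext fun s => ?_)⟩
  have hcoord : ∀ i, ∫ ω, Complex.exp (s * Complex.I * ‖Z i ω‖ ^ 2) ∂P = (1 - s * Complex.I)⁻¹ := by
    intro i
    have h := integral_cexp_mul_norm_sq_circularGaussian one_pos (β := s * Complex.I) (by simp)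
    rw [Complex.ofReal_one, mul_one] at h
    rw [← h]
    exact (hZ i).integral_comp (f := fun z => Complex.exp (s * Complex.I * ‖z‖ ^ 2))
      (Continuous.aestronglyMeasurable (by fun_prop))
  have hprod := hindep.integral_fun_prod_comp (𝕜 := ℂ)
    (f := fun _ z => Complex.exp (s * Complex.I * ‖z‖ ^ 2)) hZm fun i => by fun_prop
  simp only [hcoord, Finset.prod_const, Finset.card_univ, ← Complex.exp_sum, ← Finset.mul_sum]
    at hprod
  rw [charFun_apply_real, integral_map hsum (by fun_prop), charFun_gammaMeasure hcard one_pos]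
  push_cast
  simp_rw [mul_right_comm _ _ Complex.I]
  rw [hprod]
  simp [Complex.cpow_neg]

lemma hasLaw_sum_norm_sq_prodMk_kibbleGamma {U V : ι → Ω → ℂ} {r : ℂ}
    (hUV : ∀ i, IsCircularGaussianPair P (U i) (V i) r)
    (hindep : iIndepFun (fun i ω => (U i ω, V i ω)) P) (hr : ‖r‖ < 1) :
    HasLaw (fun ω => (∑ i, ‖U i ω‖ ^ 2, ∑ i, ‖V i ω‖ ^ 2))
      (kibbleGamma (Fintype.card ι) (‖r‖ ^ 2)) P := by
  have hr₂ : ‖r‖ ^ 2 < 1 := by nlinarith [norm_nonneg r]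
  have hU : ∀ i, AEMeasurable (U i) P := fun i => (hUV i).gaussian.fst.aemeasurable
  have hV : ∀ i, AEMeasurable (V i) P := fun i => (hUV i).gaussian.snd.aemeasurable
  have hsum : AEMeasurable (fun ω => (∑ i, ‖U i ω‖ ^ 2, ∑ i, ‖V i ω‖ ^ 2)) P := by fun_prop
  have := hindep.isProbabilityMeasure
  have := isProbabilityMeasure_kibbleGamma (Fintype.card_pos (α := ι)) (sq_nonneg ‖r‖) hr₂
  have := Measure.isProbabilityMeasure_map (μ := P) hsum
  refine ⟨hsum, ext_of_pairCharFun (funext₂ fun s t => ?_)⟩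
  have hprod := hindep.integral_fun_prod_comp (𝕜 := ℂ)
    (f := fun _ p => Complex.exp ((s * ‖p.1‖ ^ 2 + t * ‖p.2‖ ^ 2) * Complex.I))
    (fun i => (hU i).prodMk (hV i)) fun i => by fun_prop
  simp only [(hUV _).integral_cexp_norm_sq hr, Finset.prod_const, Finset.card_univ,
    ← Complex.exp_sum, ← Finset.sum_mul, Finset.sum_add_distrib, ← Finset.mul_sum] at hprod
  rw [pairCharFun, integral_map hsum (by fun_prop),
    pairCharFun_kibbleGamma Fintype.card_pos (sq_nonneg _) hr₂]
  push_cast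
  rw [hprod, inv_pow]

end SquaredNorms

section Channel

variable {Ω : Type*} [MeasurableSpace Ω] {P : Measure Ω}

lemma IsRayleighProcess.hasLaw {h : ℝ → Ω → ℂ} {ρ : ℝ → ℂ} (hh : IsRayleighProcess P h ρ) (x : ℝ) :
    HasLaw (h x) (circularGaussian 1) P :=
  hasLaw_circularGaussian (hh.gaussian.hasGaussianLaw_eval x) (hh.mean_zero x) (hh.circular x x)
    one_pos (by simpa [hh.unit_power] using hh.correlation x 0)

lemma IsRayleighProcess.isCircularGaussianPair {h : ℝ → Ω → ℂ} {ρ : ℝ → ℂ}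
    (hh : IsRayleighProcess P h ρ) (x τ : ℝ) :
    IsCircularGaussianPair P (h x) (h (x - τ)) (ρ τ) where
  gaussian := hh.gaussian.hasGaussianLaw_prodMk
  mean_fst := hh.mean_zero _
  mean_snd := hh.mean_zero _
  circular_fst := hh.circular _ _
  circular_cross := hh.circular _ _
  circular_snd := hh.circular _ _
  power_fst := by simpa [hh.unit_power] using hh.correlation x 0
  power_snd := by simpa [hh.unit_power] using hh.correlation (x - τ) 0
  correlation := hh.correlation x τ

/-- The total power gain `∑ |h_{r,t}(x)|²` of a MIMO channel at time `x`; the instantaneous mutual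
information is an increasing function of it. -/
noncomputable def channelPower {N M : ℕ} (h : Fin N → Fin M → ℝ → Ω → ℂ) (x : ℝ) (ω : Ω) : ℝ :=
  ∑ r, ∑ t, ‖h r t x ω‖ ^ 2

variable {M N : ℕ} [NeZero M] [NeZero N] {h : Fin N → Fin M → ℝ → Ω → ℂ} {ρ : ℝ → ℂ}

lemma IsRayleighMIMO.hasLaw_channelPower (hh : IsRayleighMIMO P h ρ) (x : ℝ) :
    HasLaw (channelPower h x) (gammaMeasure (M * N : ℕ) 1) P := by
  have hlaw := hasLaw_sum_norm_sq_gammaMeasure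
    (fun p : Fin N × Fin M => (hh.rayleigh p.1 p.2).hasLaw x)
    (hh.indep.comp (fun _ f => f x) fun _ => by fun_prop)
  simpa only [← channelPower.eq_def, Fintype.sum_prod_type, Fintype.card_prod, Fintype.card_fin,
    mul_comm N] using hlaw

lemma IsRayleighMIMO.hasLaw_channelPower_prodMk (hh : IsRayleighMIMO P h ρ) {τ : ℝ}
    (hρ : ‖ρ τ‖ < 1) (x : ℝ) :
    HasLaw (fun ω => (channelPower h x ω, channelPower h (x - τ) ω))
      (kibbleGamma (M * N) (‖ρ τ‖ ^ 2)) P := by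
  have hlaw := hasLaw_sum_norm_sq_prodMk_kibbleGamma
    (fun p : Fin N × Fin M => (hh.rayleigh p.1 p.2).isCircularGaussianPair x τ)
    (hh.indep.comp (fun _ f => (f x, f (x - τ))) fun _ => by fun_prop) hρ
  simpa only [← channelPower.eq_def, Fintype.sum_prod_type, Fintype.card_prod, Fintype.card_fin,
    mul_comm N] using hlaw

end Channel

section Crossings

variable {Ω : Type*} {I : ℕ → Ω → ℝ} {θ : ℝ}

lemma clip_eq_one_iff {l : ℕ} {ω : Ω} : clip I θ l ω = 1 ↔ θ ≤ I l ω := by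
  simp [clip]

lemma clip_eq_indicator (l : ℕ) : clip I θ l = {ω | clip I θ l ω = 1}.indicator 1 := by
  ext ω
  simp [clip, Set.indicator]

lemma clip_mul_clip_eq_indicator (l m : ℕ) :
    (fun ω => clip I θ l ω * clip I θ m ω) =
      {ω | clip I θ l ω = 1 ∧ clip I θ m ω = 1}.indicator 1 := by
  rw [Set.ofPred_and, Set.inter_indicator_one, ← clip_eq_indicator, ← clip_eq_indicator]
  rfl

lemma sq_clip_sub_clip (l m : ℕ) (ω : Ω) :
    (clip I θ l ω - clip I θ m ω) ^ 2 =
      2 * (clip I θ m ω * (1 - clip I θ l ω)) + (clip I θ l ω - clip I θ m ω) := by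
  unfold clip
  split_ifs <;> norm_num

lemma crossings_eq_two_mul_downCrossings_add {L : ℕ} (hL : 1 ≤ L) (ω : Ω) :
    crossings I θ L ω = 2 * downCrossings I θ L ω + (clip I θ L ω - clip I θ 1 ω) := by
  have htelescope : ∑ l ∈ Finset.Icc 2 L, (clip I θ l ω - clip I θ (l - 1) ω) =
      clip I θ L ω - clip I θ 1 ω := by
    induction L, hL using Nat.le_induction with
    | base => simp
    | succ L hL ih =>
      rw [Finset.sum_Icc_succ_top (by omega), ih, Nat.add_sub_cancel]
      ring
  simp only [crossings, downCrossings, sq_clip_sub_clip, Finset.sum_add_distrib, ← Finset.mul_sum,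
    htelescope]

variable [MeasurableSpace Ω] {P : Measure Ω}

lemma measurableSet_clip_eq_one {l : ℕ} (hI : Measurable (I l)) :
    MeasurableSet {ω | clip I θ l ω = 1} := by
  simpa only [clip_eq_one_iff] using measurableSet_le measurable_const hI

lemma integral_clip {l : ℕ} (hI : Measurable (I l)) :
    ∫ ω, clip I θ l ω ∂P = P.real {ω | clip I θ l ω = 1} := by
  rw [← integral_indicator_one (measurableSet_clip_eq_one hI), ← clip_eq_indicator]

lemma integral_clip_mul_clip {l m : ℕ} (hl : Measurable (I l)) (hm : Measurable (I m)) :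
    ∫ ω, clip I θ l ω * clip I θ m ω ∂P = P.real {ω | clip I θ l ω = 1 ∧ clip I θ m ω = 1} := by
  rw [clip_mul_clip_eq_indicator]
  exact integral_indicator_one
    ((measurableSet_clip_eq_one hl).inter (measurableSet_clip_eq_one hm))

variable [IsFiniteMeasure P]

lemma integrable_clip {l : ℕ} (hI : Measurable (I l)) : Integrable (clip I θ l) P := by
  rw [clip_eq_indicator]
  exact (integrable_const 1).indicator (measurableSet_clip_eq_one hI)

lemma integrable_clip_mul_clip {l m : ℕ} (hl : Measurable (I l)) (hm : Measurable (I m)) :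
    Integrable (fun ω => clip I θ l ω * clip I θ m ω) P := by
  rw [clip_mul_clip_eq_indicator]
  exact (integrable_const 1).indicator
    ((measurableSet_clip_eq_one hl).inter (measurableSet_clip_eq_one hm))

lemma integrable_clip_mul_one_sub_clip {l m : ℕ} (hl : Measurable (I l)) (hm : Measurable (I m)) :
    Integrable (fun ω => clip I θ m ω * (1 - clip I θ l ω)) P := by
  simp only [mul_one_sub, mul_comm (clip I θ m _) (clip I θ l _)]
  exact (integrable_clip hm).sub (integrable_clip_mul_clip hl hm)

lemma integral_clip_mul_one_sub_clip {l m : ℕ} (hl : Measurable (I l)) (hm : Measurable (I m)) :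
    ∫ ω, clip I θ m ω * (1 - clip I θ l ω) ∂P =
      P.real {ω | clip I θ m ω = 1} - P.real {ω | clip I θ l ω = 1 ∧ clip I θ m ω = 1} := by
  simp only [mul_one_sub, mul_comm (clip I θ m _) (clip I θ l _)]
  rw [integral_sub (integrable_clip hm) (integrable_clip_mul_clip hl hm), integral_clip hm,
    integral_clip_mul_clip hl hm]

lemma integrable_downCrossings (hI : ∀ l, Measurable (I l)) (L : ℕ) :
    Integrable (downCrossings I θ L) P :=
  integrable_finsetSum _ fun _ _ => integrable_clip_mul_one_sub_clip (hI _) (hI _)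

lemma crossingRate_eq_two_mul_levelCrossingRate (hI : ∀ l, Measurable (I l)) {p : ℝ}
    (hp : ∀ l, 1 ≤ l → P.real {ω | clip I θ l ω = 1} = p) (Ts : ℝ) {L : ℕ} (hL : 1 ≤ L) :
    crossingRate P I Ts θ L = 2 * levelCrossingRate P I Ts θ L := by
  have hcrossings : ∫ ω, crossings I θ L ω ∂P = 2 * ∫ ω, downCrossings I θ L ω ∂P := by
    have hboundary : Integrable (fun ω => clip I θ L ω - clip I θ 1 ω) P :=
      (integrable_clip (hI L)).sub (integrable_clip (hI 1))
    simp_rw [crossings_eq_two_mul_downCrossings_add hL]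
    rw [integral_add ((integrable_downCrossings hI L).const_mul 2) hboundary,
      integral_sub (integrable_clip (hI L)) (integrable_clip (hI 1)), integral_const_mul,
      integral_clip (hI L), integral_clip (hI 1), hp L hL, hp 1 le_rfl, sub_self, add_zero]
  rw [crossingRate, levelCrossingRate, hcrossings, mul_div_assoc]

lemma levelCrossingRate_eq (hI : ∀ l, Measurable (I l)) {p J : ℝ}
    (hp : ∀ l, 1 ≤ l → P.real {ω | clip I θ l ω = 1} = p)
    (hJ : ∀ l, 2 ≤ l → P.real {ω | clip I θ l ω = 1 ∧ clip I θ (l - 1) ω = 1} = J)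
    (Ts : ℝ) {L : ℕ} (hL : 2 ≤ L) : levelCrossingRate P I Ts θ L = (p - J) / Ts := by
  have hL₁ : (L : ℝ) - 1 ≠ 0 := by
    rw [sub_ne_zero, Nat.cast_ne_one]
    omega
  have hdown : ∫ ω, downCrossings I θ L ω ∂P = ((L : ℝ) - 1) * (p - J) := by
    simp only [downCrossings]
    rw [integral_finsetSum _ fun _ _ => integrable_clip_mul_one_sub_clip (hI _) (hI _)]
    calc ∑ l ∈ Finset.Icc 2 L, ∫ ω, clip I θ (l - 1) ω * (1 - clip I θ l ω) ∂P
        = ∑ _l ∈ Finset.Icc 2 L, (p - J) := by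
          refine Finset.sum_congr rfl fun l hl => ?_
          have hl₂ := (Finset.mem_Icc.1 hl).1
          rw [integral_clip_mul_one_sub_clip (hI l) (hI _), hp _ (by omega), hJ l hl₂]
      _ = ((L : ℝ) - 1) * (p - J) := by
          rw [Finset.sum_const, Nat.card_Icc, nsmul_eq_mul, show L + 1 - 2 = L - 1 by omega,
            Nat.cast_pred (by omega)]
  rw [levelCrossingRate, hdown, mul_div_mul_left _ _ hL₁]

end Crossings

section Capacity

variable {Ω : Type*} {M N : ℕ} {h : Fin N → Fin M → ℝ → Ω → ℂ} {η Ts θ : ℝ} {l : ℕ} {ω : Ω}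

/-- The level `M (2 ^ θ - 1) / η` of the total channel power at which the OSTBC-MIMO mutual
information with signal-to-noise ratio `η` equals `θ`. -/
noncomputable def powerThreshold (M : ℕ) (η θ : ℝ) : ℝ := M * (2 ^ θ - 1) / η

lemma powerThreshold_nonneg (hη : 0 ≤ η) (hθ : 0 ≤ θ) : 0 ≤ powerThreshold M η θ :=
  div_nonneg (mul_nonneg M.cast_nonneg (sub_nonneg.2 (Real.one_le_rpow one_le_two hθ))) hη

lemma powerThreshold_pos [NeZero M] (hη : 0 < η) (hθ : 0 < θ) : 0 < powerThreshold M η θ :=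
  div_pos (mul_pos (Nat.cast_pos.2 (NeZero.pos M)) (sub_pos.2 (Real.one_lt_rpow one_lt_two hθ))) hη

lemma ostbcIMI_eq_logb_channelPower :
    ostbcIMI η Ts h l ω = Real.logb 2 (1 + η / M * channelPower h (l * Ts) ω) := rfl

lemma channelPower_nonneg (h : Fin N → Fin M → ℝ → Ω → ℂ) (x : ℝ) (ω : Ω) :
    0 ≤ channelPower h x ω := by
  unfold channelPower
  positivity

lemma le_ostbcIMI_iff [NeZero M] (hη : 0 < η) :
    θ ≤ ostbcIMI η Ts h l ω ↔ powerThreshold M η θ ≤ channelPower h (l * Ts) ω := by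
  have hM : (0 : ℝ) < M := Nat.cast_pos.2 (NeZero.pos M)
  have hpower := channelPower_nonneg h (l * Ts) ω
  rw [ostbcIMI_eq_logb_channelPower, Real.le_logb_iff_rpow_le one_lt_two (by positivity),
    powerThreshold, div_le_iff₀ hη, ← sub_le_iff_le_add', div_mul_eq_mul_div, le_div_iff₀ hM,
    mul_comm (M : ℝ), mul_comm η]

lemma ostbcIMI_le_iff [NeZero M] (hη : 0 < η) :
    ostbcIMI η Ts h l ω ≤ θ ↔ channelPower h (l * Ts) ω ≤ powerThreshold M η θ := by
  have hM : (0 : ℝ) < M := Nat.cast_pos.2 (NeZero.pos M)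
  have hpower := channelPower_nonneg h (l * Ts) ω
  rw [ostbcIMI_eq_logb_channelPower, Real.logb_le_iff_le_rpow one_lt_two (by positivity),
    powerThreshold, le_div_iff₀ hη, ← le_sub_iff_add_le', div_mul_eq_mul_div, div_le_iff₀ hM,
    mul_comm (M : ℝ), mul_comm η]

lemma ostbcIMI_eq_sisoIMI (h : Fin 1 → Fin 1 → ℝ → Ω → ℂ) (r t : Fin 1) :
    ostbcIMI η Ts h = sisoIMI η Ts (h r t) := by
  funext l ω
  simp [ostbcIMI, sisoIMI, Subsingleton.elim r 0, Subsingleton.elim t 0]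

end Capacity

section RayleighCapacity

variable {Ω : Type*} [MeasurableSpace Ω] {P : Measure Ω} {M N : ℕ} {h : Fin N → Fin M → ℝ → Ω → ℂ}
  {ρ : ℝ → ℂ} {η Ts θ : ℝ}

lemma IsRayleighMIMO.measurable_ostbcIMI (hh : IsRayleighMIMO P h ρ) (η Ts : ℝ) (l : ℕ) :
    Measurable (ostbcIMI η Ts h l) := by
  have hmeas : ∀ r t, Measurable (h r t (l * Ts)) := fun r t => (hh.rayleigh r t).measurable _
  unfold ostbcIMI Real.logb
  fun_prop

variable [NeZero M] [NeZero N]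

lemma IsRayleighMIMO.measureReal_clip_eq_one (hh : IsRayleighMIMO P h ρ) (hη : 0 < η) (l : ℕ) :
    P.real {ω | clip (ostbcIMI η Ts h) θ l ω = 1} =
      (gammaMeasure (M * N : ℕ) 1).real (Set.Ici (powerThreshold M η θ)) := by
  simp only [clip_eq_one_iff, le_ostbcIMI_iff hη]
  exact (hh.hasLaw_channelPower (l * Ts)).measureReal_eq measurableSet_Ici

lemma IsRayleighMIMO.measureReal_clip_eq_one_and (hh : IsRayleighMIMO P h ρ) (hη : 0 < η)
    (hρ : ‖ρ Ts‖ < 1) {l : ℕ} (hl : 1 ≤ l) :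
    P.real {ω | clip (ostbcIMI η Ts h) θ l ω = 1 ∧ clip (ostbcIMI η Ts h) θ (l - 1) ω = 1} =
      (kibbleGamma (M * N) (‖ρ Ts‖ ^ 2)).real
        (Set.Ici (powerThreshold M η θ) ×ˢ Set.Ici (powerThreshold M η θ)) := by
  have hlaw := hh.hasLaw_channelPower_prodMk hρ (l * Ts)
  rw [← sub_one_mul, ← Nat.cast_pred hl] at hlaw
  simp only [clip_eq_one_iff, le_ostbcIMI_iff hη]
  exact hlaw.measureReal_eq (measurableSet_Ici.prod measurableSet_Ici)

lemma IsRayleighMIMO.measureReal_ostbcIMI_le (hh : IsRayleighMIMO P h ρ) (hη : 0 < η) (hθ : 0 ≤ θ)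
    (l : ℕ) : P.real {ω | ostbcIMI η Ts h l ω ≤ θ} =
      lowerIncGamma (M * N : ℕ) (powerThreshold M η θ) / (M * N - 1).factorial := by
  simp only [ostbcIMI_le_iff hη]
  rw [← gammaMeasure_natCast_real_Iic (Nat.mul_pos (NeZero.pos M) (NeZero.pos N))
    (powerThreshold_nonneg hη.le hθ)]
  exact (hh.hasLaw_channelPower (l * Ts)).measureReal_eq measurableSet_Iic

lemma IsRayleighMIMO.crossingRate_ostbcIMI (hh : IsRayleighMIMO P h ρ) (hη : 0 < η) {L : ℕ}
    (hL : 1 ≤ L) : crossingRate P (ostbcIMI η Ts h) Ts θ L =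
      2 * levelCrossingRate P (ostbcIMI η Ts h) Ts θ L :=
  have := hh.indep.isProbabilityMeasure
  crossingRate_eq_two_mul_levelCrossingRate (hh.measurable_ostbcIMI η Ts)
    (fun l _ => hh.measureReal_clip_eq_one hη l) Ts hL

lemma IsRayleighMIMO.levelCrossingRate_ostbcIMI (hh : IsRayleighMIMO P h ρ) (hη : 0 < η)
    (hρ : ‖ρ Ts‖ < 1) {L : ℕ} (hL : 2 ≤ L) :
    levelCrossingRate P (ostbcIMI η Ts h) Ts θ L =
      ((gammaMeasure (M * N : ℕ) 1).real (Set.Ici (powerThreshold M η θ)) -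
        (kibbleGamma (M * N) (‖ρ Ts‖ ^ 2)).real
          (Set.Ici (powerThreshold M η θ) ×ˢ Set.Ici (powerThreshold M η θ))) / Ts :=
  have := hh.indep.isProbabilityMeasure
  levelCrossingRate_eq (hh.measurable_ostbcIMI η Ts)
    (fun l _ => hh.measureReal_clip_eq_one hη l)
    (fun _ hl => hh.measureReal_clip_eq_one_and hη hρ (by omega)) Ts hL

lemma IsRayleighMIMO.levelCrossingRate_ostbcIMI_pos (hh : IsRayleighMIMO P h ρ) (hη : 0 < η)
    (hTs : 0 < Ts) (hρ : ‖ρ Ts‖ < 1) (hθ : 0 < θ) {L : ℕ} (hL : 2 ≤ L) :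
    0 < levelCrossingRate P (ostbcIMI η Ts h) Ts θ L := by
  rw [hh.levelCrossingRate_ostbcIMI hη hρ hL]
  refine div_pos (sub_pos.2 ?_) hTs
  exact kibbleGamma_real_Ici_prod_Ici_lt (Nat.mul_pos (NeZero.pos M) (NeZero.pos N))
    (sq_nonneg _) (by nlinarith [norm_nonneg (ρ Ts)]) (powerThreshold_pos hη hθ)

lemma IsRayleighMIMO.levelCrossingRate_ostbcIMI_eq_tsum (hh : IsRayleighMIMO P h ρ) (hη : 0 < η)
    (hρ : ‖ρ Ts‖ < 1) (hθ : 0 ≤ θ) {L : ℕ} (hL : 2 ≤ L) :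
    levelCrossingRate P (ostbcIMI η Ts h) Ts θ L =
      (upperIncGamma (M * N : ℕ) (powerThreshold M η θ) - (1 - ‖ρ Ts‖ ^ 2) ^ (M * N) *
        ∑' k, jointTailTerm (M * N) (‖ρ Ts‖ ^ 2) (powerThreshold M η θ / (1 - ‖ρ Ts‖ ^ 2)) k) /
          ((M * N - 1).factorial * Ts) := by
  have hMN : 0 < M * N := Nat.mul_pos (NeZero.pos M) (NeZero.pos N)
  have hx := powerThreshold_nonneg (M := M) hη.le hθ
  rw [hh.levelCrossingRate_ostbcIMI hη hρ hL, gammaMeasure_natCast_real_Ici hMN hx,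
    kibbleGamma_real_Ici_prod_Ici hMN (sq_nonneg _) (by nlinarith [norm_nonneg (ρ Ts)]) hx,
    div_mul_eq_mul_div, ← sub_div, div_div]

lemma IsRayleighMIMO.averageOutageDuration_ostbcIMI_div (hh : IsRayleighMIMO P h ρ) (hη : 0 < η)
    (hTs : Ts ≠ 0) (hρ : ‖ρ Ts‖ < 1) (hθ : 0 ≤ θ) (l : ℕ) {L : ℕ} (hL : 2 ≤ L) :
    averageOutageDuration P (ostbcIMI η Ts h) Ts θ l L / Ts =
      lowerIncGamma (M * N : ℕ) (powerThreshold M η θ) /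
        (upperIncGamma (M * N : ℕ) (powerThreshold M η θ) - (1 - ‖ρ Ts‖ ^ 2) ^ (M * N) *
          ∑' k, jointTailTerm (M * N) (‖ρ Ts‖ ^ 2)
            (powerThreshold M η θ / (1 - ‖ρ Ts‖ ^ 2)) k) := by
  rw [averageOutageDuration, hh.measureReal_ostbcIMI_le hη hθ,
    hh.levelCrossingRate_ostbcIMI_eq_tsum hη hρ hθ hL]
  field_simp

end RayleighCapacity

lemma jointTailTerm_one_sq (c z : ℝ) (k : ℕ) :
    jointTailTerm 1 (c ^ 2) z k = (c ^ k / k.factorial * upperIncGamma (k + 1) z) ^ 2 := by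
  rw [jointTailTerm, Nat.add_sub_cancel_left, Nat.cast_one, ← pow_mul, mul_comm 2 k, pow_mul]
  ring

theorem mainTheorem4 {Ω : Type*} [MeasurableSpace Ω] (P : Measure Ω) [IsProbabilityMeasure P]
    (M N : ℕ) (hM : 1 ≤ M) (hN : 1 ≤ N) (η Ts : ℝ) (hη : 0 < η) (hTs : 0 < Ts)
    (h : Fin N → Fin M → ℝ → Ω → ℂ) (ρ : ℝ → ℂ) (hh : IsRayleighMIMO P h ρ)
    (ϱ : ℝ) (hϱ : ϱ = ‖ρ Ts‖) (hϱ_lt : ϱ < 1) (θ : ℝ) (hθ : 0 ≤ θ) :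
    -- the series converges
    Summable (fun k : ℕ => ϱ ^ (2 * k) *
      upperIncGamma ((k : ℝ) + M * N) (M * (2 ^ θ - 1) / (η * (1 - ϱ ^ 2))) ^ 2 /
        (k.factorial * (M * N + k - 1).factorial)) ∧
    -- the level-crossing rate, over any number `L ≥ 2` of samples
    (∀ L : ℕ, 2 ≤ L →
      levelCrossingRate P (ostbcIMI η Ts h) Ts θ L =
        upperIncGamma (M * N) (M * (2 ^ θ - 1) / η) / ((M * N - 1).factorial * Ts) -
        (1 - ϱ ^ 2) ^ (M * N) / ((M * N - 1).factorial * Ts) *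
          ∑' k : ℕ, ϱ ^ (2 * k) *
            upperIncGamma ((k : ℝ) + M * N) (M * (2 ^ θ - 1) / (η * (1 - ϱ ^ 2))) ^ 2 /
              (k.factorial * (M * N + k - 1).factorial)) ∧
    -- it is half of the total expected crossing rate
    (∀ L : ℕ, 2 ≤ L →
      crossingRate P (ostbcIMI η Ts h) Ts θ L =
        2 * levelCrossingRate P (ostbcIMI η Ts h) Ts θ L) ∧
    -- and it is given by the one- and two-sample exceedance probabilities
    (∀ l L : ℕ, 2 ≤ l → 2 ≤ L →
      levelCrossingRate P (ostbcIMI η Ts h) Ts θ L =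
        (P.real {ω | clip (ostbcIMI η Ts h) θ l ω = 1} -
          P.real {ω | clip (ostbcIMI η Ts h) θ l ω = 1 ∧
            clip (ostbcIMI η Ts h) θ (l - 1) ω = 1}) / Ts) ∧
    -- the average outage duration
    (0 < θ → ∀ l L : ℕ, 1 ≤ l → 2 ≤ L →
      0 < levelCrossingRate P (ostbcIMI η Ts h) Ts θ L ∧
      averageOutageDuration P (ostbcIMI η Ts h) Ts θ l L / Ts =
        lowerIncGamma (M * N) (M * (2 ^ θ - 1) / η) /
          (upperIncGamma (M * N) (M * (2 ^ θ - 1) / η) -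
            (1 - ϱ ^ 2) ^ (M * N) *
              ∑' k : ℕ, ϱ ^ (2 * k) *
                upperIncGamma ((k : ℝ) + M * N) (M * (2 ^ θ - 1) / (η * (1 - ϱ ^ 2))) ^ 2 /
                  (k.factorial * (M * N + k - 1).factorial))) ∧
    -- reduction to the SISO case
    (M = 1 → N = 1 → ∀ (r : Fin N) (t : Fin M),
      ostbcIMI η Ts h = sisoIMI η Ts (h r t) ∧
      (∀ L : ℕ, 2 ≤ L →
        levelCrossingRate P (sisoIMI η Ts (h r t)) Ts θ L =
          Real.exp (-((2 ^ θ - 1) / η)) / Ts -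
          (1 - ϱ ^ 2) / Ts * ∑' k : ℕ, (ϱ ^ k / k.factorial *
            upperIncGamma ((k : ℝ) + 1) ((2 ^ θ - 1) / (η * (1 - ϱ ^ 2)))) ^ 2) ∧
      (0 < θ → ∀ l L : ℕ, 1 ≤ l → 2 ≤ L →
        averageOutageDuration P (sisoIMI η Ts (h r t)) Ts θ l L / Ts =
          (1 - Real.exp (-((2 ^ θ - 1) / η))) /
            (Real.exp (-((2 ^ θ - 1) / η)) -
              (1 - ϱ ^ 2) * ∑' k : ℕ, (ϱ ^ k / k.factorial *
                upperIncGamma ((k : ℝ) + 1) ((2 ^ θ - 1) / (η * (1 - ϱ ^ 2)))) ^ 2))) := by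
  have : NeZero M := ⟨by omega⟩
  have : NeZero N := ⟨by omega⟩
  subst hϱ
  have hsummable := summable_jointTailTerm (Nat.mul_pos hM hN) (sq_nonneg _)
    (pow_lt_one₀ (norm_nonneg (ρ Ts)) hϱ_lt two_ne_zero) (powerThreshold_nonneg (M := M) hη.le hθ)
  have hrate := fun L (hL : 2 ≤ L) => hh.levelCrossingRate_ostbcIMI_eq_tsum hη hϱ_lt hθ hL
  have hduration := fun l L (hL : 2 ≤ L) =>
    hh.averageOutageDuration_ostbcIMI_div hη hTs.ne' hϱ_lt hθ l hL
  simp only [sub_div, mul_div_right_comm _ _ ((_ : ℝ) * Ts)] at hrate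
  refine ⟨hsummable.congr fun k => ?_, ?_, fun L hL => hh.crossingRate_ostbcIMI hη (by omega),
    fun l L hl hL => ?_, fun hθ₀ l L _ hL =>
      ⟨hh.levelCrossingRate_ostbcIMI_pos hη hTs hϱ_lt hθ₀ hL, ?_⟩, ?_⟩
  · rw [jointTailTerm, powerThreshold, Nat.cast_mul, ← pow_mul, div_div]
  · simpa only [jointTailTerm, powerThreshold, Nat.cast_mul, ← pow_mul, div_div] using hrate
  · rw [hh.levelCrossingRate_ostbcIMI hη hϱ_lt hL, hh.measureReal_clip_eq_one hη,
      hh.measureReal_clip_eq_one_and hη hϱ_lt (by omega)]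
  · simpa only [jointTailTerm, powerThreshold, Nat.cast_mul, ← pow_mul, div_div]
      using hduration l L hL
  · rintro rfl rfl r t
    rw [← ostbcIMI_eq_sisoIMI h r t]
    simp only [jointTailTerm_one_sq, powerThreshold, Nat.cast_one, mul_one, one_mul, pow_one,
      Nat.sub_self, Nat.factorial_zero, upperIncGamma_one, lowerIncGamma_one, div_div]
      at hrate hduration
    exact ⟨rfl, hrate, fun _ l L _ hL => hduration l L hL⟩
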